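/- Let $r,k,m\ge 0$ be integers and let $\beta=(\beta_1,\dots,\beta_m)$ be a weak composition, i.e. a finite sequence of non-negative integers. Let $\mathcal{OP}_{r;\beta,k}$ be the set of sequences $\pi=B_1/\cdots/B_k$ of $k$ nonempty finite sets (blocks) of non-negative integers whose multiset union is $\{0^r,1^{\beta_1},\dots,m^{\beta_m}\}$ and such that, if $k\ge 1$, $0\notin B_k$ (so no letter is repeated inside a block, but a letter may occur in several blocks). For such $\pi$ let $\mathrm{inv}(\pi)$ be the number of pairs of entries $a>b$ such that $b$ is the minimum of its block and $a$ lies in a block strictly to the left of the block of $b$; that is, $$\mathrm{inv}(\pi)=\sum_{1\le i<j\le k}\bigl|\{a\in B_i : a>\min B_j\}\bigr|.$$ Let $\mathrm{miniword}(\pi)$ be the word obtained as follows: write $B_k$ in increasing order; then, for $i=k-1,\dots,1$, if $x$ is the first letter of the arrangement of $B_{i+1}$, write to the left of the word constructed so far the elements of $B_i$ greater than $x$ in increasing order followed by the elements of $B_i$ at most $x$ in increasing order. Let $$\mathrm{minimaj}(\pi)=\mathrm{maj}(\mathrm{miniword}(\pi)),\qquad \mathrm{maj}(w_1\cdots w_N)=\sum_{1\le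 i<N,\ w_i>w_{i+1}} i .$$ Then, as polynomials in $q$, $$\sum_{\pi\in\mathcal{OP}_{r;\beta,k}}q^{\mathrm{inv}(\pi)}=\sum_{\pi\in\mathcal{OP}_{r;\beta,k}}q^{\mathrm{minimaj}(\pi)}.$$ -/

import Mathlib

namespace ExtendedOMP

/-- The multiset `A(β) = {1^{β₁}, …, m^{βₘ}}` of a weak composition `β = (β₁, …, βₘ)`.
The part `βᵢ` with `1 ≤ i ≤ m` is `β (i - 1)` for the zero-based index type `Fin m`. -/
def contentMultiset {m : ℕ} (β : Fin m → ℕ) : Multiset ℕ :=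
  ∑ i : Fin m, Multiset.replicate (β i) ((i : ℕ) + 1)

/-- `π = B₁/⋯/B_k`, written as the list of its blocks, is an ordered multiset partition of the
multiset `M`: the blocks are nonempty sets (no repetition inside a block), and their multiset
union is `M`. -/
def IsOrderedMultisetPartition (M : Multiset ℕ) (π : List (Finset ℕ)) : Prop :=
  (∀ B ∈ π, B.Nonempty) ∧ (π.map Finset.val).sum = M

/-- The set `OP_{r;β,k}` of extended ordered multiset partitions: ordered multiset partitions of
`A(β) ∪ {0^r}` into `k` blocks such that `0` is not contained in the last block. -/
def OP (r : ℕ) {m : ℕ} (β : Fin m → ℕ) (k : ℕ) : Set (List (Finset ℕ)) :=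
  {π | IsOrderedMultisetPartition (contentMultiset β + Multiset.replicate r 0) π ∧
    π.length = k ∧ ∀ B ∈ π.getLast?, 0 ∉ B}

theorem OP_finite (r : ℕ) {m : ℕ} (β : Fin m → ℕ) (k : ℕ) : (OP r β k).Finite := by
  classical
  let S := (contentMultiset β + Multiset.replicate r 0).toFinset.powerset
  have hfin : {l : List {B // B ∈ S} | l.length = k}.Finite := List.finite_length_eq _ k
  refine (hfin.image (List.map Subtype.val)).subset ?_
  rintro π ⟨⟨-, hM⟩, hk, -⟩
  have hS : ∀ B ∈ π, B ∈ S := by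
    intro B hB
    rw [Finset.mem_powerset]
    intro a ha
    rw [Multiset.mem_toFinset, ← hM]
    have hle : B.val ≤ (π.map Finset.val).sum :=
      List.single_le_sum (fun _ _ => Multiset.zero_le _) _ (List.mem_map_of_mem hB)
    exact Multiset.mem_of_le hle ha
  refine ⟨π.attachWith (· ∈ S) hS, ?_, ?_⟩
  · simpa using hk
  · simp

/-- The inversion statistic: the number of pairs `a > b` such that `b` is the minimum of its
block and `a` lies in a block strictly to the left of the block of `b`. Equal letters in different
blocks are distinguished. -/
def inv (π : List (Finset ℕ)) : ℕ :=
  ∑ i : Fin π.length, ∑ j ∈ Finset.Ioi i,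
    ((π.get i ×ˢ π.get j).filter (fun p => p.2 < p.1 ∧ ∀ c ∈ π.get j, p.2 ≤ c)).card

/-- The major index of a word `w₁⋯wₙ`: the sum of the (one-based) positions `i` with
`wᵢ > wᵢ₊₁`. Here `w.getD i 0` is the letter `wᵢ₊₁`; the default value `0` is never used. -/
def wordMaj (w : List ℕ) : ℕ :=
  ∑ i ∈ Finset.range (w.length - 1), if w.getD (i + 1) 0 < w.getD i 0 then i + 1 else 0

/-- The word `miniword(B₁/⋯/B_k)`: the last block is written in increasing order; to the left of
an already arranged part beginning with the letter `x`, the next block is written as its letters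
`> x` in increasing order, followed by its letters `≤ x` in increasing order. -/
def miniword : List (Finset ℕ) → List ℕ
  | [] => []
  | B :: π =>
    match miniword π with
    | [] => B.sort
    | x :: w => (B.filter (fun a => x < a)).sort ++ (B.filter (fun a => a ≤ x)).sort ++ x :: w

/-- The minimum major index. -/
def minimaj (π : List (Finset ℕ)) : ℕ := wordMaj (miniword π)

/-- The generating function `D_{r;β,k}^{stat}(q) = ∑_{π ∈ OP_{r;β,k}} q^{stat(π)}`, a polynomial
in `q`. -/
noncomputable def D (stat : List (Finset ℕ) → ℕ) (r : ℕ) {m : ℕ} (β : Fin m → ℕ) (k : ℕ) :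
    Polynomial ℕ :=
  ∑ π ∈ (OP_finite r β k).toFinset, Polynomial.X ^ stat π

end ExtendedOMP

open Finset

namespace ExtendedOMP

/-! Give each letter `j` a weight `w j` and sum `q ^ stat * weight` over all sequences of `k`
nonempty blocks from a finite alphabet. Deleting the last block `B` leaves the same kind of sum with
some weights multiplied by `q`: for `inv`, those of the letters greater than the minimum of `B`; for
`cycMaj`, those of the letters after the first letter of `B` in a cyclic order, once the weights are
suitably twisted.

The crux is `qDiff_qProd`: for every linear order on the letters, the corresponding sum over `B` of
`qProd` at the modified weights is `qDiff` of `qProd`, so it does not depend on the order.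
Iterating, both sums are values of one function `genFun` (`sum_pow_inv`, `sum_pow_cycMaj`). With the
last block fixed, both statistics yield `genFun` at the same weights, twisted at the minimum of that
block; hence the condition that `0` is absent from the last block is harmless. The prescribed
content is then read off as a coefficient in the letter variables, with `q` made invertible by
Laurent polynomials. -/

/-! ### Sums over sequences of blocks -/

/-- The nonempty subsets of `s`. -/
def blocks (s : Finset ℕ) : Finset (Finset ℕ) := s.powerset.erase ∅

/-- The sequences of `k` nonempty subsets of `s`. -/
def blockSeqs (s : Finset ℕ) : ℕ → Finset (List (Finset ℕ))
  | 0 => {[]}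
  | k + 1 => (blocks s ×ˢ blockSeqs s k).image fun p => p.2 ++ [p.1]

theorem mem_blocks {s B : Finset ℕ} : B ∈ blocks s ↔ B.Nonempty ∧ B ⊆ s := by
  simp [blocks, Finset.nonempty_iff_ne_empty]

theorem mem_blockSeqs {s : Finset ℕ} {k : ℕ} {π : List (Finset ℕ)} :
    π ∈ blockSeqs s k ↔ π.length = k ∧ ∀ B ∈ π, B ∈ blocks s := by
  induction k generalizing π with
  | zero =>
    simp only [blockSeqs, mem_singleton, List.length_eq_zero_iff]
    constructor
    · rintro rfl; simp
    · exact And.left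
  | succ k ih =>
    simp only [blockSeqs, mem_image, mem_product, Prod.exists]
    constructor
    · rintro ⟨B, ρ, ⟨hB, hρ⟩, rfl⟩
      obtain ⟨hl, hb⟩ := ih.1 hρ
      refine ⟨by simp [hl], fun C hC => ?_⟩
      rcases List.mem_append.1 hC with h | h
      · exact hb C h
      · rw [List.mem_singleton.1 h]; exact hB
    · rintro ⟨hl, hb⟩
      rcases List.eq_nil_or_concat π with rfl | ⟨ρ, B, rfl⟩
      · simp at hl
      · rw [List.concat_eq_append] at hl hb ⊢
        refine ⟨B, ρ, ⟨hb B (by simp), ih.2 ⟨by simpa using hl, fun C hC => hb C ?_⟩⟩, rfl⟩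
        exact List.mem_append_left _ hC

theorem sum_blockSeqs_succ {R : Type*} [AddCommMonoid R] (s : Finset ℕ) (k : ℕ)
    (f : List (Finset ℕ) → R) :
    ∑ π ∈ blockSeqs s (k + 1), f π = ∑ B ∈ blocks s, ∑ π ∈ blockSeqs s k, f (π ++ [B]) := by
  rw [blockSeqs, sum_image, sum_product]
  rintro ⟨B, π⟩ - ⟨C, ρ⟩ - h
  obtain ⟨h1, h2⟩ := List.append_inj' h rfl
  simp_all

/-- The product of the weights of all letters of a sequence of blocks. -/
def weight {R : Type*} [CommMonoid R] (w : ℕ → R) (π : List (Finset ℕ)) : R :=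
  (π.map fun B => ∏ a ∈ B, w a).prod

theorem weight_append_singleton {R : Type*} [CommMonoid R] (w : ℕ → R) (π : List (Finset ℕ))
    (B : Finset ℕ) : weight w (π ++ [B]) = weight w π * ∏ a ∈ B, w a := by
  simp [weight]

theorem prod_ite_mul {R : Type*} [CommMonoid R] (q : R) (w : ℕ → R) (P : ℕ → Prop)
    [DecidablePred P] (B : Finset ℕ) :
    ∏ a ∈ B, (if P a then q * w a else w a) = q ^ #{a ∈ B | P a} * ∏ a ∈ B, w a := by
  rw [← prod_const, prod_filter, ← prod_mul_distrib]
  refine prod_congr rfl fun a _ => ?_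
  split_ifs <;> simp

theorem weight_ite_mul {R : Type*} [CommMonoid R] (q : R) (w : ℕ → R) (P : ℕ → Prop)
    [DecidablePred P] (π : List (Finset ℕ)) :
    weight (fun a => if P a then q * w a else w a) π =
      q ^ (π.map fun B => #{a ∈ B | P a}).sum * weight w π := by
  induction π with
  | nil => simp [weight]
  | cons B π ih =>
    simp only [weight, List.map_cons, List.prod_cons, List.sum_cons] at ih ⊢
    rw [ih, prod_ite_mul, pow_add]
    exact mul_mul_mul_comm _ _ _ _

theorem weight_mul {R : Type*} [CommMonoid R] (q : R) (w : ℕ → R) (π : List (Finset ℕ)) :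
    weight (fun a => q * w a) π = q ^ (π.map card).sum * weight w π := by
  simpa using weight_ite_mul q w (fun _ => True) π

/-! ### The `q`-difference operator -/

/-- The operator `A ↦ (n ↦ q⁻ⁿ (A (n + 1) - A n))`, where `qi` plays the role of `q⁻¹`. -/
def qDiff {R : Type*} [CommRing R] (qi : R) : (ℕ → R) →ₗ[R] (ℕ → R) where
  toFun A n := qi ^ n * (A (n + 1) - A n)
  map_add' A B := by ext n; simp only [Pi.add_apply]; ring
  map_smul' c A := by ext n; simp only [Pi.smul_apply, smul_eq_mul, RingHom.id_apply]; ring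

/-- The sequence `n ↦ ∏ⱼ (1 + uⱼ)(1 + q uⱼ)⋯(1 + qⁿ⁻¹ uⱼ)`. -/
def qProd {R : Type*} [CommRing R] (s : Finset ℕ) (q : R) (u : ℕ → R) (n : ℕ) : R :=
  ∏ j ∈ s, ∏ t ∈ range n, (1 + q ^ t * u j)

/-- Remove the `f`-minimal letter `x`. If `x ∉ B`, its factor is just `a x`; if `x ∈ B`, every other
letter gets `b`, and the sum over the rest of `B` factors as `∏ (1 + u j)`. By `hab` the two
contributions telescope. -/
theorem sum_powerset_prod_ite {R α : Type*} [CommRing R] [LinearOrder α] (s : Finset ℕ)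
    (f : ℕ → α) (hf : f.Injective) (z : R) (u a b e : ℕ → R) (hu : ∀ j, u j = z * e j)
    (hab : ∀ j, (1 + u j) * b j = a j * (1 + e j)) :
    ∑ B ∈ s.powerset, (∏ i ∈ B, u i) * ∏ j ∈ s, (if ∃ i ∈ B, f i < f j then b j else a j) =
      ∏ j ∈ s, a j + z * (∏ j ∈ s, a j * (1 + e j) - ∏ j ∈ s, a j) := by
  classical
  induction s using Finset.induction_on_min_value f with
  | empty => simp
  | insert x s hx hmin ih =>
    have hlt : ∀ j ∈ s, f x < f j := fun j hj =>
      lt_of_le_of_ne (hmin j hj) fun h => hx (hf h ▸ hj)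
    rw [sum_powerset_insert hx]
    have h1 : ∀ B ∈ s.powerset, (∏ i ∈ B, u i) *
        ∏ j ∈ insert x s, (if ∃ i ∈ B, f i < f j then b j else a j) =
        a x * ((∏ i ∈ B, u i) * ∏ j ∈ s, (if ∃ i ∈ B, f i < f j then b j else a j)) := by
      intro B hB
      rw [prod_insert hx, if_neg]
      · ring
      · rintro ⟨i, hi, h⟩
        exact absurd h (not_lt.2 (hmin i (mem_powerset.1 hB hi)))
    have h2 : ∀ B ∈ s.powerset, (∏ i ∈ insert x B, u i) *
        ∏ j ∈ insert x s, (if ∃ i ∈ insert x B, f i < f j then b j else a j) =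
        (∏ i ∈ B, u i) * (u x * a x * ∏ j ∈ s, b j) := by
      intro B hB
      rw [prod_insert hx, prod_insert fun h => hx (mem_powerset.1 hB h), if_neg,
        prod_congr rfl fun j hj => if_pos ⟨x, mem_insert_self _ _, hlt j hj⟩]
      · ring
      · rintro ⟨i, hi, h⟩
        rcases mem_insert.1 hi with rfl | hi
        · exact lt_irrefl _ h
        · exact absurd h (not_lt.2 (hmin i (mem_powerset.1 hB hi)))
    rw [sum_congr rfl h1, sum_congr rfl h2, ← mul_sum, ih, ← sum_mul, ← prod_one_add,
      prod_insert hx, prod_insert hx]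
    have h3 : ∏ j ∈ s, a j * (1 + e j) = (∏ j ∈ s, (1 + u j)) * ∏ j ∈ s, b j := by
      rw [← prod_mul_distrib]
      exact prod_congr rfl fun j _ => (hab j).symm
    rw [h3, hu x]
    ring

theorem qDiff_qProd {R α : Type*} [CommRing R] [LinearOrder α] (s : Finset ℕ) (f : ℕ → α)
    (hf : f.Injective) (q qi : R) (hq : q * qi = 1) (u : ℕ → R) :
    qDiff qi (qProd s q u) = ∑ B ∈ blocks s, (∏ i ∈ B, u i) •
      qProd s q (fun j => if ∃ i ∈ B, f i < f j then q * u j else u j) := by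
  ext n
  have key := sum_powerset_prod_ite s f hf (qi ^ n) u
    (fun j => ∏ t ∈ range n, (1 + q ^ t * u j)) (fun j => ∏ t ∈ range n, (1 + q ^ t * (q * u j)))
    (fun j => q ^ n * u j)
    (fun j => by rw [← mul_assoc, ← mul_pow, mul_comm qi, hq, one_pow, one_mul])
    -- Both sides are the product of `1 + q ^ t * u j` over `t ≤ n`, with the factor `t = 0` or `t =
    -- n` split off.
    (fun j => by
      rw [← prod_range_succ (fun t => 1 + q ^ t * u j), prod_range_succ']
      simp only [pow_succ, pow_zero, one_mul, mul_assoc]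
      ring)
  -- The term `B = ∅` cancels the isolated product of the `a j`, leaving the sum over nonempty
  -- blocks.
  rw [← add_sum_erase _ _ (empty_mem_powerset s)] at key
  simp only [notMem_empty, false_and, exists_false, if_false, prod_empty, one_mul,
    add_right_inj] at key
  simp only [Finset.sum_apply, Pi.smul_apply, smul_eq_mul, blocks]
  simp only [← prod_range_succ (fun t => 1 + q ^ t * u _)] at key
  refine key.symm.trans (sum_congr rfl fun B _ => ?_)
  congr 1
  refine prod_congr rfl fun j _ => ?_
  by_cases h : ∃ i ∈ B, f i < f j <;> simp only [h, if_true, if_false]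

/-- The common generating function of the two statistics over all sequences of `k` blocks. -/
def genFun {R : Type*} [CommRing R] (s : Finset ℕ) (q qi : R) (k : ℕ) (u : ℕ → R) : R :=
  (qDiff qi ^ k) (qProd s q u) 0

/-- The operator is linear, so its `k`-th power can be applied termwise to the expansion in
`qDiff_qProd`; the order `f` disappears from the result. -/
theorem sum_genFun {R α : Type*} [CommRing R] [LinearOrder α] (s : Finset ℕ) (f : ℕ → α)
    (hf : f.Injective) (q qi : R) (hq : q * qi = 1) (k : ℕ) (u : ℕ → R) :
    ∑ B ∈ blocks s, (∏ i ∈ B, u i) *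
      genFun s q qi k (fun j => if ∃ i ∈ B, f i < f j then q * u j else u j) =
      genFun s q qi (k + 1) u := by
  simp only [genFun]
  rw [pow_succ, Module.End.mul_apply, qDiff_qProd s f hf q qi hq, map_sum, Finset.sum_apply]
  simp only [map_smul, Pi.smul_apply, smul_eq_mul]

/-! ### Inversions -/

theorem inv_cons (B : Finset ℕ) (π : List (Finset ℕ)) :
    inv (B :: π) =
      (π.map fun C => #{p ∈ B ×ˢ C | p.2 < p.1 ∧ ∀ c ∈ C, p.2 ≤ c}).sum + inv π := by
  refine (Fin.sum_univ_succ (n := π.length) _).trans ?_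
  unfold inv
  congr 1
  · refine (Fin.sum_Ioi_zero (n := π.length) _).trans ?_
    rw [← Fin.sum_univ_fun_getElem]
    rfl
  · refine sum_congr rfl fun i _ => ?_
    exact Fin.sum_Ioi_succ (n := π.length) _ _

theorem card_filter_min (B C : Finset ℕ) (hC : C.Nonempty) :
    #{p ∈ B ×ˢ C | p.2 < p.1 ∧ ∀ c ∈ C, p.2 ≤ c} = #{a ∈ B | ∃ i ∈ C, i < a} := by
  refine (card_bij (fun a _ => (a, C.min' hC)) ?_ ?_ ?_).symm
  · intro a ha
    obtain ⟨haB, i, hi, hia⟩ := mem_filter.1 ha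
    exact mem_filter.2 ⟨mem_product.2 ⟨haB, C.min'_mem hC⟩,
      (C.min'_le i hi).trans_lt hia, fun c hc => C.min'_le c hc⟩
  · intro a _ b _ h
    exact (Prod.ext_iff.1 h).1
  · rintro ⟨a, b⟩ h
    simp only [mem_filter, mem_product] at h
    obtain ⟨⟨ha, hb⟩, hlt, hmin⟩ := h
    refine ⟨a, mem_filter.2 ⟨ha, b, hb, hlt⟩, ?_⟩
    rw [le_antisymm (C.min'_le b hb) (hmin _ (C.min'_mem hC))]

theorem inv_append_singleton (π : List (Finset ℕ)) (B : Finset ℕ) (hB : B.Nonempty) :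
    inv (π ++ [B]) = inv π + (π.map fun C => #{a ∈ C | ∃ i ∈ B, i < a}).sum := by
  induction π with
  | nil => simp [inv_cons]
  | cons C π ih =>
    rw [List.cons_append, inv_cons, ih, inv_cons, List.map_append, List.sum_append, List.map_cons,
      List.sum_cons]
    simp only [List.map_cons, List.map_nil, List.sum_cons, List.sum_nil]
    rw [card_filter_min C B hB]
    omega

theorem pow_inv_append_mul_weight {R : Type*} [CommRing R] (q : R) (w : ℕ → R)
    (π : List (Finset ℕ)) (B : Finset ℕ) (hB : B.Nonempty) :
    q ^ inv (π ++ [B]) * weight w (π ++ [B]) = (∏ i ∈ B, w i) *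
      (q ^ inv π * weight (fun j => if ∃ i ∈ B, i < j then q * w j else w j) π) := by
  rw [inv_append_singleton π B hB, weight_append_singleton, weight_ite_mul, pow_add]
  ring

theorem sum_pow_inv {R : Type*} [CommRing R] (s : Finset ℕ) (q qi : R) (hq : q * qi = 1) (k : ℕ)
    (w : ℕ → R) : ∑ π ∈ blockSeqs s k, q ^ inv π * weight w π = genFun s q qi k w := by
  induction k generalizing w with
  | zero => simp [blockSeqs, inv, weight, genFun, qProd]
  | succ k ih =>
    rw [sum_blockSeqs_succ, ← sum_genFun s id Function.injective_id q qi hq]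
    refine sum_congr rfl fun B hB => ?_
    rw [sum_congr rfl fun π _ => pow_inv_append_mul_weight q w π B (mem_blocks.1 hB).1,
      ← mul_sum, ih]
    rfl

/-! ### The major index of words -/

/-- The number of descents of a word. -/
def wordDes (w : List ℕ) : ℕ :=
  ∑ i ∈ range (w.length - 1), if w.getD (i + 1) 0 < w.getD i 0 then 1 else 0

theorem wordDes_cons {v : List ℕ} (hv : v ≠ []) (a : ℕ) :
    wordDes (a :: v) = wordDes v + if v.headD 0 < a then 1 else 0 := by
  obtain ⟨b, v, rfl⟩ := List.exists_cons_of_ne_nil hv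
  simp only [wordDes, List.length_cons, Nat.add_sub_cancel]
  rw [sum_range_succ']
  rfl

/-- Prepending a letter moves every old descent one position to the right, hence the term `wordDes
v`. -/
theorem wordMaj_cons {v : List ℕ} (hv : v ≠ []) (a : ℕ) :
    wordMaj (a :: v) = wordMaj v + wordDes v + if v.headD 0 < a then 1 else 0 := by
  obtain ⟨b, v, rfl⟩ := List.exists_cons_of_ne_nil hv
  simp only [wordMaj, wordDes, List.length_cons, Nat.add_sub_cancel]
  rw [sum_range_succ', ← sum_add_distrib]
  congr 1
  refine sum_congr rfl fun i _ => ?_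
  simp only [List.getD_cons_succ]
  split_ifs <;> rfl

theorem wordDes_wordMaj_append_of_le {u v : List ℕ} (hv : v ≠ []) (hu : u.SortedLE)
    (h : ∀ a ∈ u, a ≤ v.headD 0) :
    wordDes (u ++ v) = wordDes v ∧ wordMaj (u ++ v) = wordMaj v + u.length * wordDes v := by
  induction u with
  | nil => simp
  | cons a u ih =>
    have hp := List.pairwise_cons.1 hu.pairwise
    obtain ⟨h1, h2⟩ := ih hp.2.sortedLE fun b hb => h b (List.mem_cons_of_mem _ hb)
    have hne : u ++ v ≠ [] := by simp [hv]
    have hle : ¬ (u ++ v).headD 0 < a := by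
      rw [not_lt]
      cases u with
      | nil => exact h a (by simp)
      | cons b u => exact hp.1 b (by simp)
    rw [List.cons_append, wordDes_cons hne, wordMaj_cons hne, if_neg hle, h1, h2, List.length_cons]
    constructor <;> ring

theorem wordDes_wordMaj_append_of_gt {u v : List ℕ} (hv : v ≠ []) (hu : u.SortedLE) (hne : u ≠ [])
    (h : ∀ a ∈ u, v.headD 0 < a) :
    wordDes (u ++ v) = wordDes v + 1 ∧
      wordMaj (u ++ v) = wordMaj v + u.length * (wordDes v + 1) := by
  induction u with
  | nil => exact absurd rfl hne
  | cons a u ih =>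
    rcases u with _ | ⟨b, u⟩
    · rw [List.singleton_append, wordDes_cons hv, wordMaj_cons hv, if_pos (h a (by simp))]
      constructor
      · rfl
      · simp; ring
    · have hp := List.pairwise_cons.1 hu.pairwise
      obtain ⟨h1, h2⟩ := ih hp.2.sortedLE (by simp) fun b hb => h b (List.mem_cons_of_mem _ hb)
      have hle : ¬ (b :: u ++ v).headD 0 < a := not_lt.2 (hp.1 b (by simp))
      rw [List.cons_append, wordDes_cons (by simp), wordMaj_cons (by simp), if_neg hle, h1, h2,
        List.length_cons (a := a)]
      constructor <;> ring

theorem wordMaj_append_singleton {w : List ℕ} {c : ℕ} (h : ∀ a ∈ w, a ≤ c) :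
    wordMaj (w ++ [c]) = wordMaj w ∧ wordDes (w ++ [c]) = wordDes w := by
  induction w with
  | nil => simp [wordMaj, wordDes]
  | cons a w ih =>
    obtain ⟨h1, h2⟩ := ih fun b hb => h b (List.mem_cons_of_mem _ hb)
    rcases w with _ | ⟨b, w⟩
    · have : a ≤ c := h a (by simp)
      simp [wordMaj, wordDes, this]
    · rw [List.cons_append, wordMaj_cons (by simp), wordDes_cons (by simp), h1, h2,
        wordMaj_cons (v := b :: w) (by simp), wordDes_cons (v := b :: w) (by simp)]
      exact ⟨rfl, rfl⟩

/-! ### The minimum major index -/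

/-- The letters of `B` in the cyclic order in which the letters `> c` precede the others. -/
def cycWord (c : ℕ) (B : Finset ℕ) : List ℕ :=
  (B.filter (fun a => c < a)).sort ++ (B.filter (fun a => a ≤ c)).sort

/-- The word obtained by writing the blocks of `π` to the left of `v`, from right to left, each in
the cyclic order determined by the first letter written so far. -/
def extendWord (v : List ℕ) : List (Finset ℕ) → List ℕ
  | [] => v
  | B :: π => cycWord ((extendWord v π).headD 0) B ++ extendWord v π

theorem extendWord_ne_nil {v : List ℕ} (hv : v ≠ []) (π : List (Finset ℕ)) :
    extendWord v π ≠ [] := by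
  cases π with
  | nil => exact hv
  | cons B π => simp [extendWord, extendWord_ne_nil hv π]

theorem headD_extendWord {v v' : List ℕ} (h : v.headD 0 = v'.headD 0) (π : List (Finset ℕ)) :
    (extendWord v π).headD 0 = (extendWord v' π).headD 0 := by
  induction π with
  | nil => exact h
  | cons B π ih =>
    simp only [extendWord, ih]
    cases cycWord ((extendWord v' π).headD 0) B with
    | nil => exact ih
    | cons a u => rfl

theorem extendWord_append_singleton (v : List ℕ) (π : List (Finset ℕ)) (B : Finset ℕ) :
    extendWord v (π ++ [B]) = extendWord (cycWord (v.headD 0) B ++ v) π := by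
  induction π with
  | nil => rfl
  | cons C π ih => simp only [List.cons_append, extendWord, ih]

/-- The only possible new descent follows the run of letters above the head of `v`, so its position
is the length of that run; old descents shift by `#B`. -/
theorem wordDes_wordMaj_cycWord_append {v : List ℕ} (hv : v ≠ []) (B : Finset ℕ) :
    wordDes (cycWord (v.headD 0) B ++ v) =
        wordDes v + (if ∃ a ∈ B, v.headD 0 < a then 1 else 0) ∧
      wordMaj (cycWord (v.headD 0) B ++ v) =
        wordMaj v + #B * wordDes v + #{a ∈ B | v.headD 0 < a} := by
  set c := v.headD 0
  set lo := (B.filter (fun a => a ≤ c)).sort with hlo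
  obtain ⟨h1, h2⟩ := wordDes_wordMaj_append_of_le (u := lo) hv ((pairwise_sort _ _).sortedLE)
    fun a ha => (mem_filter.1 ((mem_sort _).1 ha)).2
  have hcard : #{a ∈ B | c < a} + #{a ∈ B | a ≤ c} = #B := by
    simpa using card_filter_add_card_filter_not (s := B) (fun a => c < a)
  rw [cycWord, List.append_assoc]
  by_cases h : ∃ a ∈ B, c < a
  · obtain ⟨a, haB, ha⟩ := h
    have hhead : (lo ++ v).headD 0 ≤ c := by
      rcases hl : lo with _ | ⟨b, l⟩
      · exact le_rfl
      · have : b ∈ lo := by simp [hl]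
        exact (mem_filter.1 ((mem_sort _).1 this)).2
    obtain ⟨h3, h4⟩ := wordDes_wordMaj_append_of_gt (u := (B.filter (fun a => c < a)).sort)
      (v := lo ++ v) (by simp [hv]) ((pairwise_sort _ _).sortedLE)
      (List.ne_nil_of_mem ((mem_sort _).2 (mem_filter.2 ⟨haB, ha⟩)))
      fun b hb => hhead.trans_lt (mem_filter.1 ((mem_sort _).1 hb)).2
    rw [h3, h4, h1, h2, if_pos ⟨a, haB, ha⟩, length_sort, length_sort, ← hcard]
    exact ⟨rfl, by ring⟩
  · have he : B.filter (fun a => c < a) = ∅ :=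
      filter_eq_empty_iff.2 fun a ha hca => h ⟨a, ha, hca⟩
    rw [he, card_empty, zero_add] at hcard
    rw [if_neg h, he, sort_empty, List.nil_append, h1, h2, hlo, length_sort, hcard]
    simp

/-- The cyclic variant of the minimum major index, for blocks followed by the letter `c`. -/
def cycMaj (c : ℕ) (π : List (Finset ℕ)) : ℕ := wordMaj (extendWord [c] π)

/-- The arrangement of `π` depends on `v` only through its first letter; the descents inside `v`
merely shift by the total size of `π`. -/
theorem wordDes_wordMaj_extendWord {v : List ℕ} (hv : v ≠ []) (π : List (Finset ℕ)) :
    wordDes (extendWord v π) = wordDes v + wordDes (extendWord [v.headD 0] π) ∧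
      wordMaj (extendWord v π) =
        wordMaj v + wordDes v * (π.map card).sum + cycMaj (v.headD 0) π := by
  unfold cycMaj
  induction π with
  | nil => simp [extendWord, wordDes, wordMaj]
  | cons B π ih =>
    obtain ⟨h1, h2⟩ := ih
    have hh := headD_extendWord (v := v) (v' := [v.headD 0]) rfl π
    obtain ⟨h3, h4⟩ := wordDes_wordMaj_cycWord_append (extendWord_ne_nil hv π) B
    obtain ⟨h5, h6⟩ := wordDes_wordMaj_cycWord_append
      (extendWord_ne_nil (List.cons_ne_nil (v.headD 0) []) π) B
    simp only [extendWord]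
    rw [h3, h4, h5, h6, h1, h2, hh, List.map_cons, List.sum_cons]
    constructor <;> ring

/-- The first letter of `B` in the cyclic order starting after `c`. -/
def cycFirst (c : ℕ) (B : Finset ℕ) : ℕ := (cycWord c B ++ [c]).headD 0

theorem headD_sort {B : Finset ℕ} (hB : B.Nonempty) (v : List ℕ) :
    (B.sort ++ v).headD 0 ∈ B ∧ ∀ i ∈ B, (B.sort ++ v).headD 0 ≤ i := by
  have hs : B.sort.SortedLE := (pairwise_sort _ _).sortedLE
  have hm : ∀ i, i ∈ B.sort ↔ i ∈ B := fun i => mem_sort _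
  rcases hl : B.sort with _ | ⟨b, l⟩
  · obtain ⟨i, hi⟩ := hB
    simp [← hm, hl] at hi
  · rw [hl] at hs hm
    rw [hl, List.cons_append, List.headD_cons]
    refine ⟨(hm b).1 (by simp), fun i hi => ?_⟩
    rcases List.mem_cons.1 ((hm i).2 hi) with rfl | h
    · exact le_rfl
    · exact (List.pairwise_cons.1 hs.pairwise).1 i h

theorem cycFirst_of_exists {c : ℕ} {B : Finset ℕ} (h : ∃ a ∈ B, c < a) :
    cycFirst c B ∈ B ∧ c < cycFirst c B ∧ ∀ i ∈ B, c < i → cycFirst c B ≤ i := by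
  obtain ⟨a, ha, hca⟩ := h
  obtain ⟨h1, h2⟩ := headD_sort (B := B.filter (fun a => c < a)) ⟨a, mem_filter.2 ⟨ha, hca⟩⟩
    ((B.filter (fun a => a ≤ c)).sort ++ [c])
  rw [← List.append_assoc] at h1 h2
  exact ⟨(mem_filter.1 h1).1, (mem_filter.1 h1).2, fun i hi hci => h2 i (mem_filter.2 ⟨hi, hci⟩)⟩

theorem cycFirst_of_le {c : ℕ} {B : Finset ℕ} (hB : B.Nonempty) (h : ∀ a ∈ B, a ≤ c) :
    cycFirst c B ∈ B ∧ ∀ i ∈ B, cycFirst c B ≤ i := by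
  have h1 : B.filter (fun a => c < a) = ∅ :=
    filter_eq_empty_iff.2 fun a ha => not_lt.2 (h a ha)
  have h2 : B.filter (fun a => a ≤ c) = B := filter_eq_self.2 h
  rw [cycFirst, cycWord, h1, h2, sort_empty, List.nil_append]
  exact headD_sort hB _

theorem cycMaj_append_singleton (c : ℕ) (π : List (Finset ℕ)) (B : Finset ℕ) :
    cycMaj c (π ++ [B]) = #{a ∈ B | c < a} +
      (if ∃ a ∈ B, c < a then 1 else 0) * (π.map card).sum + cycMaj (cycFirst c B) π := by
  obtain ⟨h1, h2⟩ := wordDes_wordMaj_cycWord_append (List.cons_ne_nil c []) B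
  rw [List.headD_cons] at h1 h2
  rw [cycMaj, extendWord_append_singleton, List.headD_cons,
    (wordDes_wordMaj_extendWord (v := cycWord c B ++ [c]) (by simp) π).2, h1, h2]
  simp [wordDes, wordMaj, cycFirst]

/-- The weights `w`, with those of the letters `> c` multiplied by `q`. -/
def twist {R : Type*} [CommRing R] (q : R) (c : ℕ) (w : ℕ → R) (j : ℕ) : R :=
  if c < j then q * w j else w j

/-- A key that sorts the letters `> c` before the others. -/
def cycKey (c j : ℕ) : ℕ ×ₗ ℕ := toLex (if c < j then 0 else 1, j)

theorem cycKey_injective (c : ℕ) : (cycKey c).Injective := fun _ _ h =>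
  congrArg (fun p => (ofLex p).2) h

theorem cycKey_lt {c i j : ℕ} :
    cycKey c i < cycKey c j ↔ (c < i ∧ j ≤ c) ∨ ((c < i ↔ c < j) ∧ i < j) := by
  simp only [cycKey, Prod.Lex.toLex_lt_toLex]
  split_ifs <;> simp <;> omega

/-- This matches the `cycMaj` recursion to `sum_genFun` for the order `cycKey c`. If `B` has a
letter above `c`, the extra descent multiplies all weights by `q`; for `j ≤ c` this is the factor
due to `j` coming cyclically after the first letter of `B`, and for `j > c` it is the twist at `c`.
-/
theorem twist_cycFirst {R : Type*} [CommRing R] (q : R) (c : ℕ) (w : ℕ → R) {B : Finset ℕ}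
    (hB : B.Nonempty) :
    twist q (cycFirst c B) (fun j => if ∃ a ∈ B, c < a then q * w j else w j) =
      fun j => if ∃ i ∈ B, cycKey c i < cycKey c j then q * twist q c w j else twist q c w j := by
  ext j
  simp only [twist, cycKey_lt]
  by_cases h : ∃ a ∈ B, c < a
  · obtain ⟨h1, h2, h3⟩ := cycFirst_of_exists h
    simp only [if_pos h]
    rcases lt_or_ge c j with hj | hj
    · rw [if_pos hj]
      refine if_congr ⟨fun hx => ⟨_, h1, Or.inr ⟨by simp [h2, hj], hx⟩⟩, ?_⟩ rfl rfl
      rintro ⟨i, hi, h | h⟩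
      · omega
      · exact (h3 i hi (h.1.2 hj)).trans_lt h.2
    · rw [if_neg (show ¬ cycFirst c B < j by omega), if_neg (show ¬ c < j by omega),
        if_pos ⟨_, h1, Or.inl ⟨h2, hj⟩⟩]
  · have hle : ∀ a ∈ B, a ≤ c := fun a ha => not_lt.1 fun hca => h ⟨a, ha, hca⟩
    obtain ⟨h1, h3⟩ := cycFirst_of_le hB hle
    have h2 := hle _ h1
    simp only [if_neg h]
    rcases lt_or_ge c j with hj | hj
    · rw [if_pos (by omega), if_pos hj, if_neg]
      rintro ⟨i, hi, h | h⟩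
      · omega
      · have := hle i hi
        omega
    · rw [if_neg (show ¬ c < j by omega)]
      refine if_congr ⟨fun hx => ⟨_, h1, Or.inr ⟨by omega, hx⟩⟩, ?_⟩ rfl rfl
      rintro ⟨i, hi, h | h⟩
      · have := hle i hi
        omega
      · exact (h3 i hi).trans_lt h.2

theorem pow_cycMaj_append_mul_weight {R : Type*} [CommRing R] (q : R) (w : ℕ → R) (c : ℕ)
    (π : List (Finset ℕ)) (B : Finset ℕ) :
    q ^ cycMaj c (π ++ [B]) * weight w (π ++ [B]) = (∏ i ∈ B, twist q c w i) *
      (q ^ cycMaj (cycFirst c B) π *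
        weight (fun j => if ∃ a ∈ B, c < a then q * w j else w j) π) := by
  rw [cycMaj_append_singleton, weight_append_singleton]
  simp only [twist]
  rw [prod_ite_mul, pow_add, pow_add]
  by_cases h : ∃ a ∈ B, c < a
  · simp only [if_pos h, weight_mul]
    ring
  · simp only [if_neg h]
    ring

theorem sum_pow_cycMaj {R : Type*} [CommRing R] (s : Finset ℕ) (q qi : R) (hq : q * qi = 1)
    (k c : ℕ) (w : ℕ → R) :
    ∑ π ∈ blockSeqs s k, q ^ cycMaj c π * weight w π = genFun s q qi k (twist q c w) := by
  induction k generalizing w c with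
  | zero => simp [blockSeqs, cycMaj, extendWord, wordMaj, weight, genFun, qProd]
  | succ k ih =>
    rw [sum_blockSeqs_succ, ← sum_genFun s (cycKey c) (cycKey_injective c) q qi hq]
    refine sum_congr rfl fun B hB => ?_
    rw [sum_congr rfl fun π _ => pow_cycMaj_append_mul_weight q w c π B, ← mul_sum, ih,
      twist_cycFirst q c w (mem_blocks.1 hB).1]

/-- A final letter `c` bounding all others creates no descent and leaves the last block in
increasing order. -/
theorem minimaj_eq_cycMaj {c : ℕ} {π : List (Finset ℕ)} (h : ∀ B ∈ π, ∀ a ∈ B, a ≤ c) :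
    minimaj π = cycMaj c π := by
  have key : extendWord [c] π = miniword π ++ [c] ∧ ∀ a ∈ miniword π, a ≤ c := by
    induction π with
    | nil => simp [extendWord, miniword]
    | cons B π ih =>
      obtain ⟨h1, h2⟩ := ih fun C hC => h C (List.mem_cons_of_mem _ hC)
      have hB := h B (by simp)
      simp only [extendWord, miniword]
      rw [h1]
      rcases hw : miniword π with _ | ⟨x, w⟩
      · have e1 : B.filter (fun a => c < a) = ∅ :=
          filter_eq_empty_iff.2 fun a ha => not_lt.2 (hB a ha)
        have e2 : B.filter (fun a => a ≤ c) = B := filter_eq_self.2 hB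
        refine ⟨?_, fun a ha => hB a ((mem_sort _).1 ha)⟩
        simp [cycWord, e1, e2]
      · refine ⟨by simp [cycWord], fun a ha => ?_⟩
        rw [List.mem_append, List.mem_append, mem_sort, mem_sort, mem_filter, mem_filter] at ha
        rcases ha with (ha | ha) | ha
        · exact hB a ha.1
        · exact hB a ha.1
        · exact h2 a (hw ▸ ha)
  rw [minimaj, cycMaj, key.1, (wordMaj_append_singleton key.2).1]

/-! ### Equidistribution -/

/-- The inversion number and the minimum major index are equidistributed over the sequences with a
given last block. -/
theorem sum_pow_inv_eq_sum_pow_minimaj {R : Type*} [CommRing R] (s : Finset ℕ) (q qi : R)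
    (hq : q * qi = 1) (k : ℕ) (w : ℕ → R) {B : Finset ℕ} (hB : B ∈ blocks s) :
    ∑ π ∈ blockSeqs s k, q ^ inv (π ++ [B]) * weight w (π ++ [B]) =
      ∑ π ∈ blockSeqs s k, q ^ minimaj (π ++ [B]) * weight w (π ++ [B]) := by
  obtain ⟨hne, hBs⟩ := mem_blocks.1 hB
  have hc : ∀ a ∈ s, a ≤ s.sup id := fun a ha => le_sup (f := id) ha
  have hBc : ∀ a ∈ B, a ≤ s.sup id := fun a ha => hc a (hBs ha)
  obtain ⟨h1, h2⟩ := cycFirst_of_le hne hBc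
  have hmm : ∀ π ∈ blockSeqs s k, q ^ minimaj (π ++ [B]) * weight w (π ++ [B]) =
      (∏ i ∈ B, w i) * (q ^ cycMaj (cycFirst (s.sup id) B) π * weight w π) := by
    intro π hπ
    have hall : ∀ C ∈ π ++ [B], ∀ a ∈ C, a ≤ s.sup id := by
      intro C hC a ha
      rcases List.mem_append.1 hC with h | h
      · exact hc a ((mem_blocks.1 ((mem_blockSeqs.1 hπ).2 C h)).2 ha)
      · exact hBc a (List.mem_singleton.1 h ▸ ha)
    have hno : ¬ ∃ a ∈ B, s.sup id < a := by
      rintro ⟨a, ha, h⟩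
      exact absurd (hBc a ha) (not_le.2 h)
    rw [minimaj_eq_cycMaj hall, pow_cycMaj_append_mul_weight]
    simp only [if_neg hno]
    congr 1
    exact prod_congr rfl fun a ha => if_neg (not_lt.2 (hBc a ha))
  rw [sum_congr rfl hmm, sum_congr rfl fun π _ => pow_inv_append_mul_weight q w π B hne,
    ← mul_sum, ← mul_sum, sum_pow_inv s q qi hq, sum_pow_cycMaj s q qi hq]
  -- Both sides are `genFun`; since no letter of `B` exceeds `s.sup id`, `cycFirst` is the minimum
  -- of `B`, so the modified weights agree.
  congr 2
  ext j
  refine if_congr ⟨?_, fun h => ⟨_, h1, h⟩⟩ rfl rfl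
  rintro ⟨i, hi, h⟩
  exact (h2 i hi).trans_lt h

/-! ### Extraction of a prescribed content as a coefficient -/

theorem weight_X {K : Type*} [CommRing K] (π : List (Finset ℕ)) :
    weight (MvPolynomial.X : ℕ → MvPolynomial ℕ K) π =
      MvPolynomial.monomial (Multiset.toFinsupp (π.map Finset.val).sum) 1 := by
  induction π with
  | nil => simp [weight]
  | cons B π ih =>
    simp only [weight, List.map_cons, List.prod_cons, List.sum_cons] at ih ⊢
    rw [ih, map_add, ← one_mul (1 : K), ← MvPolynomial.monomial_mul, one_mul]
    congr 1
    induction B using Finset.induction_on with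
    | empty => simp
    | insert a B ha ihB =>
      rw [prod_insert ha, ihB, insert_val_of_notMem ha, ← Multiset.singleton_add, map_add,
        Multiset.toFinsupp_singleton, MvPolynomial.X, MvPolynomial.monomial_mul, one_mul]

theorem coeff_pow_mul_weight {K : Type*} [CommRing K] (t : K) (n : ℕ) (M : Multiset ℕ)
    (π : List (Finset ℕ)) :
    MvPolynomial.coeff (Multiset.toFinsupp M)
      (MvPolynomial.C t ^ n * weight MvPolynomial.X π) =
      if (π.map Finset.val).sum = M then t ^ n else 0 := by
  rw [weight_X, ← map_pow, MvPolynomial.coeff_C_mul, MvPolynomial.coeff_monomial]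
  simp

theorem toFinset_OP_succ (r : ℕ) {m : ℕ} (β : Fin m → ℕ) (k : ℕ) :
    (OP_finite r β (k + 1)).toFinset =
      {π ∈ blockSeqs (contentMultiset β + Multiset.replicate r 0).toFinset (k + 1) |
        (∀ B ∈ π.getLast?, 0 ∉ B) ∧
          (π.map Finset.val).sum = contentMultiset β + Multiset.replicate r 0} := by
  ext π
  rw [Set.Finite.mem_toFinset, mem_filter, mem_blockSeqs]
  simp only [mem_blocks]
  constructor
  · rintro ⟨⟨hne, hM⟩, hk, h0⟩
    refine ⟨⟨hk, fun B hB => ⟨hne B hB, fun a ha => ?_⟩⟩, h0, hM⟩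
    rw [Multiset.mem_toFinset, ← hM]
    exact Multiset.mem_of_le (List.single_le_sum (fun _ _ => Multiset.zero_le _) _
      (List.mem_map_of_mem hB)) ha
  · rintro ⟨⟨hk, hb⟩, h0, hM⟩
    exact ⟨⟨fun B hB => (hb B hB).1, hM⟩, hk, h0⟩

theorem sum_OP_eq_coeff {K : Type*} [CommRing K] (t : K) (stat : List (Finset ℕ) → ℕ) (r : ℕ)
    {m : ℕ} (β : Fin m → ℕ) (k : ℕ) :
    ∑ π ∈ (OP_finite r β (k + 1)).toFinset, t ^ stat π =
      MvPolynomial.coeff (Multiset.toFinsupp (contentMultiset β + Multiset.replicate r 0))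
        (∑ B ∈ blocks (contentMultiset β + Multiset.replicate r 0).toFinset,
          if 0 ∉ B then
            ∑ π ∈ blockSeqs (contentMultiset β + Multiset.replicate r 0).toFinset k,
              MvPolynomial.C t ^ stat (π ++ [B]) * weight MvPolynomial.X (π ++ [B])
          else 0) := by
  rw [toFinset_OP_succ, sum_filter, sum_blockSeqs_succ, MvPolynomial.coeff_sum]
  refine sum_congr rfl fun B _ => ?_
  by_cases h0 : 0 ∈ B
  · simp [h0]
  · rw [if_pos h0, MvPolynomial.coeff_sum]
    refine sum_congr rfl fun π _ => ?_
    rw [coeff_pow_mul_weight]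
    simp [h0]

end ExtendedOMP

theorem mainTheorem3 (r : ℕ) {m : ℕ} (β : Fin m → ℕ) (k : ℕ) :
    ExtendedOMP.D ExtendedOMP.inv r β k = ExtendedOMP.D ExtendedOMP.minimaj r β k := by
  cases k with
  | zero =>
    refine sum_congr rfl fun π hπ => ?_
    rw [Set.Finite.mem_toFinset] at hπ
    rw [List.length_eq_zero_iff.1 hπ.2.1]
    rfl
  | succ k =>
    -- The operator `qDiff` needs an inverse of `q`, so the identity is transported injectively to
    -- Laurent polynomials over `ℤ`.
    have hinj : Function.Injective
        fun p : Polynomial ℕ => Polynomial.toLaurent (p.map (Nat.castRingHom ℤ)) :=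
      fun a b h => Polynomial.map_injective _ (RingHom.injective_nat _)
        (Polynomial.toLaurent_injective h)
    have himage : ∀ stat : List (Finset ℕ) → ℕ,
        Polynomial.toLaurent ((ExtendedOMP.D stat r β (k + 1)).map (Nat.castRingHom ℤ)) =
        ∑ π ∈ (ExtendedOMP.OP_finite r β (k + 1)).toFinset,
          (LaurentPolynomial.T 1 : LaurentPolynomial ℤ) ^ stat π := by
      intro stat
      simp [ExtendedOMP.D, Polynomial.map_sum]
    have hq : (MvPolynomial.C (LaurentPolynomial.T 1) : MvPolynomial ℕ (LaurentPolynomial ℤ)) *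
        MvPolynomial.C (LaurentPolynomial.T (-1)) = 1 := by
      rw [← map_mul, ← LaurentPolynomial.T_add]
      simp
    apply hinj
    beta_reduce
    rw [himage, himage, ExtendedOMP.sum_OP_eq_coeff, ExtendedOMP.sum_OP_eq_coeff]
    refine congrArg (MvPolynomial.coeff _) (sum_congr rfl fun B hB => ?_)
    exact if_congr Iff.rfl (ExtendedOMP.sum_pow_inv_eq_sum_pow_minimaj _ _ _ hq k _ hB) rfl
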